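/- Let $d\ge 2$ be an integer, let $\sigma_{d-1}$ be the usual surface measure on the unit sphere $\mathbb S^{d-1}\subset\mathbb R^d$, and let $\omega_{d-1}=\sigma_{d-1}(\mathbb S^{d-1})$. For $f\in L^2(\mathbb S^{d-1})$ write $$\widehat{f\sigma}_{d-1}(x)=\int_{\mathbb S^{d-1}}f(\omega)\,e^{-ix\cdot\omega}\,d\sigma_{d-1}(\omega),\qquad x\in\mathbb R^d,$$ and, for real $q\ge q_d:=2\frac{d+1}{d-1}$ and $f\neq 0$, $$\Phi_{d,q}(f)=\frac{\|\widehat{f\sigma}_{d-1}\|_{L^q(\mathbb R^d)}^q}{\|f\|_{L^2(\mathbb S^{d-1})}^q},\qquad \gamma_d(q)=\omega_{d-1}\,\frac{1+q}{2d+q-\delta_{d,4}},$$ where $\delta_{d,4}=1$ if $d=4$ and $\delta_{d,4}=0$ otherwise. Let $\mathbf 1$ denote the constant function $1$ on $\mathbb S^{d-1}$. Then there is $q_\star=q_\star(d)\in[q_d,\infty)$ such that, for every real $q\ge q_\star$, the function $\widehat{\mathbf 1\sigma}_{d-1}$ belongs to $L^q(\mathbb R^d)$ (so that $\Phi_{d,q}(\mathbf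 1)$ and $\Phi_{d,q+2}(\mathbf 1)$ are finite) and $$\Phi_{d,q+2}(\mathbf 1)>\gamma_d(q)\,\Phi_{d,q}(\mathbf 1).$$ -/

import Mathlib

open MeasureTheory

noncomputable section

namespace SphereExtension

/-- The unit sphere `S^{d-1}` of `ℝ^d`. -/
abbrev Sphere (d : ℕ) : Type :=
  Metric.sphere (0 : EuclideanSpace ℝ (Fin d)) 1

/-- The usual surface measure `σ_{d-1}` on the unit sphere (not normalized). -/
def surfaceMeasure (d : ℕ) : Measure (Sphere d) :=
  (volume : Measure (EuclideanSpace ℝ (Fin d))).toSphere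

/-- The total surface area `ω_{d-1} = σ_{d-1}(S^{d-1})`. -/
def area (d : ℕ) : ℝ :=
  (surfaceMeasure d Set.univ).toReal

/-- The Fourier extension operator `x ↦ ∫ f(ω) e^{-i x·ω} dσ_{d-1}(ω)`. -/
def extension (d : ℕ) (f : Sphere d → ℂ) (x : EuclideanSpace ℝ (Fin d)) : ℂ :=
  ∫ ω : Sphere d,
    f ω * Complex.exp (-(Complex.I * ((inner ℝ x (ω : EuclideanSpace ℝ (Fin d)) : ℝ) : ℂ)))
      ∂(surfaceMeasure d)

/-- The functional `Φ_{d,q}(f) = ‖extension f‖_{L^q(ℝ^d)}^q / ‖f‖_{L^2(S^{d-1})}^q`,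
for a real exponent `q` and a function `f` in `L^2` of the sphere. -/
def Phi (d : ℕ) (q : ℝ) (f : Sphere d → ℂ) : ℝ :=
  (eLpNorm (extension d f) (ENNReal.ofReal q) volume).toReal ^ q /
    (eLpNorm f 2 (surfaceMeasure d)).toReal ^ q

/-- The constant function `1` on the sphere. -/
def one (d : ℕ) : Sphere d → ℂ := fun _ => 1

/-- `γ_d(q) = ω_{d-1} (1 + q) / (2 d + q - δ_{d,4})`. -/
def gamma (d : ℕ) (q : ℝ) : ℝ :=
  area d * ((1 + q) / (2 * (d : ℝ) + q - (if d = 4 then 1 else 0)))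

end SphereExtension

end

/-!
Let `u` be the normalized Fourier transform of the surface measure (`sphereMean`), which is real
and radial. Since `extension d (one d) = ω_{d-1} u`, one has `Φ_q(1) = ω_{d-1}^{q/2} I(q)` with
`I(q) = ∫ |u|^q`, and the claim becomes `(1 + q) I(q) < (2d + q - δ) I(q + 2)` for large `q`.

For large `q` the integral concentrates near the origin, where `u(x) = 1 - |x|²/(2d) + O(|x|⁴)`.
Substituting `x = y / √q` gives `q^{d/2} I(q) → G` with `G = ∫ exp(-|y|²/(2d))`, and
`q^{d/2+1} (I(q) - I(q + 2)) = q^{d/2} ∫ q (1 - u²) |u|^q → ∫ (|y|²/d) exp(-|y|²/(2d)) = d G`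
(`tendsto_integral_abs_sphereMean_rpow`, `tendsto_integral_mul_one_sub_sq`,
`integral_norm_sq_mul_gaussian`). The claim is therefore true for large `q` as soon as
`d < 2d - 1 - δ`, which holds for every `d ≥ 2` (`eventually_ratio_lt`).

Dominated convergence requires one bound on `|u(y/√q)|^q` for all large `q`. It is provided by
`u(x)² ≤ (1 + |x|²)^{-β}` for some `β > 0` and *all* `x` (`sphereMean_sq_le`), because
`(1 + |y|²/q)^q` increases with `q` (`abs_sphereMean_rpow_le`). This decay follows without any
theory of Bessel functions: invariance of the surface measure under reflections gives the equation
`f'' + ((d-1)/r) f' + f = 0` for the radial profile `f` of `u` (`radial_helmholtz`), and for its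
solutions a suitable perturbation of the energy `f² + f'²` decreases at a polynomial rate from its
value `1` at the origin (`sq_le_rpow_of_radial_helmholtz`).
-/

namespace SphereExtension

open Filter Topology

variable {d : ℕ}

/-! ### Decay for the radial Helmholtz equation -/

/-- Bernoulli's inequality for `(1 + t)⁻¹ = 1 - t / (1 + t)`. -/
theorem rpow_neg_le_one_sub {s t : ℝ} (hs0 : 0 ≤ s) (hs1 : s ≤ 1) (ht : 0 ≤ t) :
    (1 + t) ^ (-s) ≤ 1 - s * (t / (1 + t)) := by
  have h1 : 0 < 1 + t := by linarith
  have h2 : (1 + t) ^ (-s) = (1 + -(t / (1 + t))) ^ s := by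
    rw [Real.rpow_neg h1.le, ← Real.inv_rpow h1.le]
    congr 1
    field_simp
    ring
  have h3 : t / (1 + t) ≤ 1 := (div_le_one h1).2 (by linarith)
  rw [h2]
  have := rpow_one_add_le_one_add_mul_self (s := -(t / (1 + t))) (by linarith) hs0 hs1
  linarith

/-- With `ψ = k r / (1 + r ^ 2)` and `H = f ^ 2 + f' ^ 2 + ψ f f'`, the left-hand side is
`H' + (ψ / 2) H` along a solution of `f'' + (n / r) f' + f = 0` at which `f r = a` and
`f' r = b`. It is a quadratic form in `(a, b)`, and `k` is small enough to make it negative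
semidefinite for every `r > 0`: the cross term in `H` turns part of the damping of `f'` into
damping of `f`. -/
theorem lyapunov_form_nonpos {n r a b k : ℝ} (hn : 1 ≤ n) (hk : k = 1 / (n + 2) ^ 2) (hr : 0 < r) :
    k * r / (1 + r ^ 2) / 2 * (a ^ 2 + b ^ 2 + k * r / (1 + r ^ 2) * (a * b)) +
      (2 * a * b + 2 * b * (-a - n / r * b) +
        (k * (1 - r ^ 2) / (1 + r ^ 2) ^ 2 * (a * b) +
          k * r / (1 + r ^ 2) * (b * b + a * (-a - n / r * b)))) ≤ 0 := by
  have hk0 : 0 < k := by rw [hk]; positivity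
  have hk1 : k * (n + 2) ^ 2 = 1 := by rw [hk]; field_simp
  have hk9 : k ≤ 1 / 9 := by
    have h9 : (9 : ℝ) ≤ (n + 2) ^ 2 := by nlinarith
    nlinarith [mul_le_mul_of_nonneg_left h9 hk0.le]
  have hD : 0 < 1 + r ^ 2 := by positivity
  -- Over a common denominator, the form is `-(A a² + B b² - C r a b)` with
  -- `A = k r² D`, `B ≥ n D²` and `C² ≤ 4 k D²`, so its discriminant is nonpositive.
  set D := 1 + r ^ 2 with hDdef
  have key : k * r / D / 2 * (a ^ 2 + b ^ 2 + k * r / D * (a * b)) +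
      (2 * a * b + 2 * b * (-a - n / r * b) +
        (k * (1 - r ^ 2) / D ^ 2 * (a * b) +
          k * r / D * (b * b + a * (-a - n / r * b)))) =
      (-(k * r ^ 2 * D) * a ^ 2 + (3 * k * r ^ 2 * D - 4 * n * D ^ 2) * b ^ 2
        + (k ^ 2 * r ^ 2 + 2 * k * (1 - r ^ 2) - 2 * k * n * D) * r * (a * b)) /
        (2 * r * D ^ 2) := by
    field_simp
    ring
  rw [key]
  apply div_nonpos_of_nonpos_of_nonneg _ (by positivity)
  set C := k ^ 2 * r ^ 2 + 2 * k * (1 - r ^ 2) - 2 * k * n * D with hC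
  have hC1 : C ≤ 2 * k * (n + 2) * D := by
    have h1 : k * (k * r ^ 2) ≤ k * D :=
      mul_le_mul_of_nonneg_left (by nlinarith [sq_nonneg r]) hk0.le
    have h2 : 0 ≤ k * r ^ 2 := by positivity
    have h3 : k * r ^ 2 ≤ k * D := mul_le_mul_of_nonneg_left (by linarith) hk0.le
    have h4 : k * 1 ≤ k * D := mul_le_mul_of_nonneg_left (by nlinarith [sq_nonneg r]) hk0.le
    have h5 : 0 ≤ n * (k * D) := by positivity
    rw [hC]
    linarith
  have hC2 : -(2 * k * (n + 2) * D) ≤ C := by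
    have h1 : 0 ≤ k ^ 2 * r ^ 2 := by positivity
    have h2 : k * r ^ 2 ≤ k * D := mul_le_mul_of_nonneg_left (by linarith) hk0.le
    have h3 : 0 ≤ k * D := by positivity
    rw [hC]
    linarith
  have hCC : C ^ 2 ≤ 4 * k * D ^ 2 := by
    have h1 : C ^ 2 ≤ (2 * k * (n + 2) * D) ^ 2 := sq_le_sq' hC2 hC1
    have h2 : (2 * k * (n + 2) * D) ^ 2 = 4 * k * D ^ 2 * (k * (n + 2) ^ 2) := by ring
    rw [h2, hk1, mul_one] at h1
    exact h1
  have hB : 3 * k * r ^ 2 * D - 4 * n * D ^ 2 ≤ -(n * D ^ 2) := by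
    have : k * (r ^ 2 * D) ≤ n * D ^ 2 := by
      have : r ^ 2 * D ≤ D ^ 2 := by nlinarith
      nlinarith [sq_nonneg D]
    nlinarith
  have hb2 : (3 * k * r ^ 2 * D - 4 * n * D ^ 2) * b ^ 2 ≤ -(n * D ^ 2) * b ^ 2 :=
    mul_le_mul_of_nonneg_right hB (sq_nonneg b)
  -- Completing the square in `a`; what is left is nonnegative because `1 ≤ n D`.
  have hmul : 0 ≤ 4 * k * D * (k * r ^ 2 * D * a ^ 2 + n * D ^ 2 * b ^ 2 - C * r * (a * b)) := by
    have h1 : 0 ≤ (2 * k * r * D * a - C * b) ^ 2 := sq_nonneg _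
    have h2 : C ^ 2 * b ^ 2 ≤ 4 * k * D ^ 2 * b ^ 2 :=
      mul_le_mul_of_nonneg_right hCC (sq_nonneg b)
    have h3 : 4 * k * D ^ 2 * b ^ 2 ≤ 4 * k * n * D ^ 3 * b ^ 2 := by
      have : 0 ≤ 4 * k * D ^ 2 * b ^ 2 := by positivity
      have h4 : 1 ≤ n * D := by nlinarith [sq_nonneg r]
      calc 4 * k * D ^ 2 * b ^ 2 ≤ 4 * k * D ^ 2 * b ^ 2 * (n * D) :=
            le_mul_of_one_le_right this h4
        _ = _ := by ring
    have h5 : 4 * k * D * (k * r ^ 2 * D * a ^ 2 + n * D ^ 2 * b ^ 2 - C * r * (a * b)) =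
        (2 * k * r * D * a - C * b) ^ 2 + (4 * k * n * D ^ 3 * b ^ 2 - C ^ 2 * b ^ 2) := by ring
    rw [h5]
    linarith
  have hfin := nonneg_of_mul_nonneg_right hmul (by positivity)
  linarith

/-- The solution of `f'' + (n / r) f' + f = 0` with `f 0 = 1`, `f' 0 = 0` decays like a power
of `r`. The exponent is far from the true one, `n / 2` for `|f|`, but the constant is `1`: the
bound holds on all of `[0, ∞)` and is an equality at `r = 0`, so that it can be raised to the
power `q` uniformly in `q`. -/
theorem sq_le_rpow_of_radial_helmholtz {n k : ℝ} (hn : 1 ≤ n) (hk : k = 1 / (n + 2) ^ 2)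
    {f g : ℝ → ℝ} (hf : ∀ r, HasDerivAt f (g r) r) (hgc : Continuous g)
    (hg : ∀ r, 0 < r → HasDerivAt g (-f r - n / r * g r) r)
    (hf0 : f 0 = 1) (hg0 : g 0 = 0) {r : ℝ} (hr : 0 ≤ r) :
    f r ^ 2 ≤ (1 + r ^ 2) ^ (-(k / 8)) := by
  have hk0 : 0 < k := by rw [hk]; positivity
  have hk1 : k * (n + 2) ^ 2 = 1 := by rw [hk]; field_simp
  have hk9 : k ≤ 1 / 9 := by
    have h9 : (9 : ℝ) ≤ (n + 2) ^ 2 := by nlinarith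
    nlinarith [mul_le_mul_of_nonneg_left h9 hk0.le]
  have hfc : Continuous f := continuous_iff_continuousAt.2 fun r => (hf r).continuousAt
  have hpos : ∀ r : ℝ, 0 < 1 + r ^ 2 := fun r => by positivity
  set ψ : ℝ → ℝ := fun r => k * r / (1 + r ^ 2) with hψ
  set H : ℝ → ℝ := fun r => f r ^ 2 + g r ^ 2 + ψ r * (f r * g r) with hH
  have hψd : ∀ r, HasDerivAt ψ (k * (1 - r ^ 2) / (1 + r ^ 2) ^ 2) r := fun r => by
    have h := ((hasDerivAt_id r).const_mul k).div
      (((hasDerivAt_id r).pow 2).const_add 1) (hpos r).ne'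
    refine h.congr_deriv ?_
    simp
    ring
  have hψc : Continuous ψ := continuous_iff_continuousAt.2 fun r => (hψd r).continuousAt
  set P : ℝ → ℝ := fun r => (1 + r ^ 2) ^ (k / 4) * H r with hP
  -- `(k / 4) log (1 + r ^ 2)` is a primitive of `ψ / 2`, so this weight absorbs the decay of `H`.
  have hPanti : AntitoneOn P (Set.Ici 0) := by
    refine antitoneOn_of_hasDerivWithinAt_nonpos (convex_Ici 0)
      (f' := fun r => (1 + r ^ 2) ^ (k / 4) *
        (ψ r / 2 * H r + (2 * f r * g r + 2 * g r * (-f r - n / r * g r) +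
          (k * (1 - r ^ 2) / (1 + r ^ 2) ^ 2 * (f r * g r) +
            ψ r * (g r * g r + f r * (-f r - n / r * g r)))))) ?_ ?_ ?_
    · refine Continuous.continuousOn ?_
      refine Continuous.mul ?_ (by fun_prop)
      exact (by fun_prop : Continuous fun r : ℝ => 1 + r ^ 2).rpow_const
        fun r => Or.inl (hpos r).ne'
    · intro r hr
      rw [interior_Ici] at hr
      have hr : 0 < r := hr
      have h1 := (((hasDerivAt_id r).pow 2).const_add 1).rpow_const (p := k / 4)
        (Or.inl (hpos r).ne')
      have h2 := (((hf r).pow 2).add ((hg r hr).pow 2)).add ((hψd r).mul ((hf r).mul (hg r hr)))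
      have h3 := h1.mul h2
      refine (h3.congr_deriv ?_).hasDerivWithinAt
      simp only [id, Pi.pow_apply, Pi.mul_apply, Pi.add_apply, hH, hψ]
      rw [Real.rpow_sub_one (hpos r).ne']
      have := (hpos r).ne'
      field_simp
      ring
    · intro r hr
      rw [interior_Ici] at hr
      exact mul_nonpos_of_nonneg_of_nonpos (Real.rpow_nonneg (hpos r).le _)
        (lyapunov_form_nonpos hn hk hr)
  have hP1 : P r ≤ 1 := by
    have := hPanti (Set.self_mem_Ici) hr hr
    simpa [hP, hH, hf0, hg0] using this
  have hψsq : ψ r ^ 2 / 4 ≤ k / 8 * (r ^ 2 / (1 + r ^ 2)) := by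
    have : ψ r ^ 2 = k ^ 2 * (r ^ 2 / (1 + r ^ 2)) * (1 / (1 + r ^ 2)) := by
      simp only [hψ]; field_simp
    have h1 : 1 / (1 + r ^ 2) ≤ 1 := by
      rw [div_le_one (hpos r)]; nlinarith [sq_nonneg r]
    have h2 : 0 ≤ r ^ 2 / (1 + r ^ 2) := by positivity
    have h3 : ψ r ^ 2 ≤ k ^ 2 * (r ^ 2 / (1 + r ^ 2)) := by
      rw [this]; exact mul_le_of_le_one_right (by positivity) h1
    have h4 : k ^ 2 ≤ k / 2 := by nlinarith
    nlinarith [mul_le_mul_of_nonneg_right h4 h2]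
  have hbern := rpow_neg_le_one_sub (s := k / 8) (t := r ^ 2) (by positivity) (by linarith)
    (sq_nonneg r)
  -- Completing the square in `g r` costs only the factor `1 - ψ ^ 2 / 4`, which is at least
  -- `(1 + r ^ 2) ^ (-k / 8)`, half of the decay of `H`.
  have hHlow : (1 - ψ r ^ 2 / 4) * f r ^ 2 ≤ H r := by
    simp only [hH]
    nlinarith [sq_nonneg (g r + ψ r / 2 * f r)]
  have hx := Real.rpow_pos_of_pos (hpos r) (-(k / 8))
  set X := (1 + r ^ 2) ^ (-(k / 8)) with hX
  have hXX : (1 + r ^ 2) ^ (k / 4) * X ^ 2 = 1 := by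
    rw [hX, ← Real.rpow_mul_natCast (hpos r).le, ← Real.rpow_add (hpos r)]
    convert Real.rpow_zero _ using 2
    push_cast
    ring
  have hY := Real.rpow_pos_of_pos (hpos r) (k / 4)
  have h5 : X * f r ^ 2 ≤ H r :=
    (mul_le_mul_of_nonneg_right (by linarith) (sq_nonneg _)).trans hHlow
  have h6 : H r ≤ X ^ 2 := by
    have : P r ≤ (1 + r ^ 2) ^ (k / 4) * X ^ 2 := by rw [hXX]; exact hP1
    exact le_of_mul_le_mul_left this hY
  have h7 : X * f r ^ 2 ≤ X * X := by nlinarith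
  exact le_of_mul_le_mul_left h7 hx

/-! ### Isometry invariance of the surface measure -/

instance : IsFiniteMeasure (surfaceMeasure d) := by
  unfold surfaceMeasure; infer_instance

open scoped Pointwise in
/-- The surface measure is invariant under linear isometries. -/
theorem map_surfaceMeasure_linearIsometryEquiv
    (T : EuclideanSpace ℝ (Fin d) ≃ₗᵢ[ℝ] EuclideanSpace ℝ (Fin d)) :
    (surfaceMeasure d).map (fun ω : Sphere d => (⟨T ω, by simp⟩ : Sphere d)) =
      surfaceMeasure d := by
  have hm : Measurable (fun ω : Sphere d => (⟨T ω, by simp⟩ : Sphere d)) :=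
    (Continuous.subtype_mk (by fun_prop) _).measurable
  ext s hs
  rw [Measure.map_apply hm hs, surfaceMeasure, Measure.toSphere_apply' _ hs,
    Measure.toSphere_apply' _ (hm hs),
    ← T.measurePreserving.measure_preimage_emb T.toHomeomorph.measurableEmbedding
      (Set.Ioo (0 : ℝ) 1 • (Subtype.val '' s : Set (EuclideanSpace ℝ (Fin d))))]
  congr 2
  ext x
  simp only [Set.mem_smul, Set.mem_image, Set.mem_preimage, Subtype.exists,
    exists_and_right, exists_eq_right]
  constructor
  · rintro ⟨r, hr, y, ⟨hy, hys⟩, rfl⟩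
    exact ⟨r, hr, T y, ⟨by simpa using hy, hys⟩, by simp⟩
  · rintro ⟨r, hr, y, ⟨hy, hys⟩, h⟩
    refine ⟨r, hr, T.symm y, ⟨by simpa using hy, by simpa using hys⟩, ?_⟩
    rw [← map_smul, h]
    exact T.symm_apply_apply x

theorem integral_comp_linearIsometryEquiv
    (T : EuclideanSpace ℝ (Fin d) ≃ₗᵢ[ℝ] EuclideanSpace ℝ (Fin d))
    {F : EuclideanSpace ℝ (Fin d) → ℝ} (hF : Continuous F) :
    ∫ ω : Sphere d, F (T ω) ∂(surfaceMeasure d) = ∫ ω : Sphere d, F ω ∂(surfaceMeasure d) := by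
  have hm : Measurable (fun ω : Sphere d => (⟨T ω, by simp⟩ : Sphere d)) :=
    (Continuous.subtype_mk (by fun_prop) _).measurable
  conv_rhs => rw [← map_surfaceMeasure_linearIsometryEquiv T]
  rw [integral_map hm.aemeasurable]
  exact (hF.comp continuous_subtype_val).aestronglyMeasurable

theorem integrable_sphere {F : Sphere d → ℝ} (hF : Continuous F) :
    Integrable F (surfaceMeasure d) :=
  hF.integrable_of_hasCompactSupport (HasCompactSupport.of_compactSpace F)

theorem area_pos (hd : 2 ≤ d) : 0 < area d := by
  have : NeZero d := ⟨by omega⟩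
  have : Nonempty (Fin d) := ⟨0⟩
  have : surfaceMeasure d ≠ 0 := by unfold surfaceMeasure; simp
  rw [area]
  exact ENNReal.toReal_pos (by simpa using this) (measure_ne_top _ _)

/-- The normalized Fourier transform of the surface measure: the average of `cos ⟪x, ω⟫` over
`ω` in the unit sphere. The sine part of the exponential averages to `0`. -/
noncomputable def sphereMean (d : ℕ) (x : EuclideanSpace ℝ (Fin d)) : ℝ :=
  (area d)⁻¹ * ∫ ω : Sphere d, Real.cos (inner ℝ x (ω : EuclideanSpace ℝ (Fin d)))
    ∂(surfaceMeasure d)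

theorem extension_one (hd : 2 ≤ d) (x : EuclideanSpace ℝ (Fin d)) :
    extension d (one d) x = ((area d * sphereMean d x : ℝ) : ℂ) := by
  have hA := (area_pos hd).ne'
  have hsin : ∫ ω : Sphere d, Real.sin (inner ℝ x (ω : EuclideanSpace ℝ (Fin d)))
      ∂(surfaceMeasure d) = 0 := by
    have h := integral_comp_linearIsometryEquiv (d := d) (LinearIsometryEquiv.neg ℝ)
      (F := fun y => Real.sin (inner ℝ x y)) (by fun_prop)
    simp only [LinearIsometryEquiv.coe_neg, inner_neg_right, Real.sin_neg, integral_neg] at h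
    linarith
  have hpt : ∀ ω : Sphere d,
      one d ω * Complex.exp (-(Complex.I * ((inner ℝ x (ω : EuclideanSpace ℝ (Fin d)) : ℝ) : ℂ))) =
        ((Real.cos (inner ℝ x (ω : EuclideanSpace ℝ (Fin d))) : ℝ) : ℂ) -
        ((Real.sin (inner ℝ x (ω : EuclideanSpace ℝ (Fin d))) : ℝ) : ℂ) * Complex.I := fun ω => by
    rw [one, one_mul, ← mul_neg, mul_comm, Complex.exp_mul_I]
    simp [sub_eq_add_neg]
  simp only [extension, hpt]
  rw [integral_sub, integral_mul_const, integral_complex_ofReal, integral_complex_ofReal, hsin,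
    sphereMean, mul_inv_cancel_left₀ hA]
  · simp
  · exact (integrable_sphere (F := fun ω => Real.cos (inner ℝ x ω.1)) (by fun_prop)).ofReal
  · exact (integrable_sphere
      (F := fun ω => Real.sin (inner ℝ x ω.1)) (by fun_prop)).ofReal.mul_const _

/-- The reflection in the hyperplane orthogonal to `x - y` exchanges `x` and `y`. -/
theorem inner_reflection_sub {x y : EuclideanSpace ℝ (Fin d)} (h : ‖x‖ = ‖y‖)
    (z : EuclideanSpace ℝ (Fin d)) : inner ℝ y ((ℝ ∙ (x - y))ᗮ.reflection z) = inner ℝ x z := by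
  conv_lhs => enter [2]; rw [← Submodule.reflection_sub h]
  exact LinearIsometryEquiv.inner_map_map _ x z

theorem sphereMean_eq_of_norm_eq {x y : EuclideanSpace ℝ (Fin d)} (h : ‖x‖ = ‖y‖) :
    sphereMean d x = sphereMean d y := by
  have h1 := integral_comp_linearIsometryEquiv ((ℝ ∙ (x - y))ᗮ.reflection)
    (F := fun z => Real.cos (inner ℝ y z)) (by fun_prop)
  rw [sphereMean, sphereMean, ← h1]
  simp_rw [inner_reflection_sub h]

theorem integral_const_one : ∫ _ω : Sphere d, (1 : ℝ) ∂(surfaceMeasure d) = area d := by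
  simp [area, Measure.real]

theorem sum_sq_sphere (ω : Sphere d) : ∑ j, (ω : EuclideanSpace ℝ (Fin d)) j ^ 2 = 1 := by
  have h : ‖(ω : EuclideanSpace ℝ (Fin d))‖ = 1 := by simp
  rw [EuclideanSpace.norm_eq] at h
  simpa using h

theorem integral_coord_sq (hd : 2 ≤ d) (i : Fin d) :
    ∫ ω : Sphere d, (ω : EuclideanSpace ℝ (Fin d)) i ^ 2 ∂(surfaceMeasure d) = area d / d := by
  have hswap : ∀ j : Fin d, ∫ ω : Sphere d, (ω : EuclideanSpace ℝ (Fin d)) j ^ 2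
      ∂(surfaceMeasure d) = ∫ ω : Sphere d, (ω : EuclideanSpace ℝ (Fin d)) i ^ 2
      ∂(surfaceMeasure d) := fun j => by
    have h := integral_comp_linearIsometryEquiv (d := d)
      (LinearIsometryEquiv.piLpCongrLeft 2 ℝ ℝ (Equiv.swap i j))
      (F := fun y => y j ^ 2) (by fun_prop)
    rw [← h]
    simp [LinearIsometryEquiv.piLpCongrLeft_apply, Equiv.piCongrLeft']
  have hsum : ∑ j : Fin d, ∫ ω : Sphere d, (ω : EuclideanSpace ℝ (Fin d)) j ^ 2
      ∂(surfaceMeasure d) = area d := by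
    rw [← integral_finsetSum _ fun j _ => integrable_sphere (by fun_prop)]
    simp_rw [sum_sq_sphere]
    exact integral_const_one
  simp only [hswap, Finset.sum_const, Finset.card_univ, Fintype.card_fin, nsmul_eq_mul] at hsum
  have : (d : ℝ) ≠ 0 := by positivity
  rw [← hsum]; field_simp

theorem integral_inner_sq (hd : 2 ≤ d) (x : EuclideanSpace ℝ (Fin d)) :
    ∫ ω : Sphere d, inner ℝ x (ω : EuclideanSpace ℝ (Fin d)) ^ 2 ∂(surfaceMeasure d) =
      area d * (‖x‖ ^ 2 / d) := by
  have : NeZero d := ⟨by omega⟩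
  have hn : ‖x‖ = ‖‖x‖ • EuclideanSpace.single (0 : Fin d) (1 : ℝ)‖ := by
    simp [norm_smul]
  have h1 := integral_comp_linearIsometryEquiv
    ((ℝ ∙ (x - ‖x‖ • EuclideanSpace.single (0 : Fin d) (1 : ℝ)))ᗮ.reflection)
    (F := fun z => (inner ℝ (‖x‖ • EuclideanSpace.single (0 : Fin d) (1 : ℝ)) z) ^ 2) (by fun_prop)
  simp only [inner_reflection_sub hn] at h1
  rw [h1]
  simp only [inner_smul_left, EuclideanSpace.inner_single_left, mul_pow, integral_const_mul]
  simp [integral_coord_sq hd]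
  ring

/-! ### The radial Helmholtz equation for spherical averages -/

/-- Differentiation under the integral sign over the sphere. -/
theorem hasDerivAt_integral_sphere {F F' : ℝ → Sphere d → ℝ} (hF : ∀ t, Continuous (F t))
    (hF' : Continuous (Function.uncurry F')) (h : ∀ t ω, HasDerivAt (fun t => F t ω) (F' t ω) t)
    (t : ℝ) :
    HasDerivAt (fun t => ∫ ω, F t ω ∂(surfaceMeasure d)) (∫ ω, F' t ω ∂(surfaceMeasure d)) t := by
  obtain ⟨B, hB⟩ := ((isCompact_Icc (a := t - 1) (b := t + 1)).prod
    (isCompact_univ (X := Sphere d))).exists_bound_of_continuousOn hF'.continuousOn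
  refine (hasDerivAt_integral_of_dominated_loc_of_deriv_le (s := Set.Icc (t - 1) (t + 1))
    (bound := fun _ => B) (Icc_mem_nhds (by linarith) (by linarith))
    (Filter.Eventually.of_forall fun t => (hF t).aestronglyMeasurable) (integrable_sphere (hF t))
    (hF'.comp (Continuous.prodMk_right t)).aestronglyMeasurable
    (Filter.Eventually.of_forall fun ω s hs => hB (s, ω) ⟨hs, Set.mem_univ _⟩)
    (integrable_const B) (Filter.Eventually.of_forall fun ω s _ => h s ω)).2

/-- The integrand is odd under the reflection in the hyperplane orthogonal to `v`. -/
theorem integral_inner_mul_sin_eq_zero {v w : EuclideanSpace ℝ (Fin d)} (h : inner ℝ v w = 0) :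
    ∫ ω : Sphere d, inner ℝ v (ω : EuclideanSpace ℝ (Fin d)) *
      Real.sin (inner ℝ w (ω : EuclideanSpace ℝ (Fin d))) ∂(surfaceMeasure d) = 0 := by
  have h1 := integral_comp_linearIsometryEquiv ((ℝ ∙ v)ᗮ.reflection)
    (F := fun z => inner ℝ v z * Real.sin (inner ℝ w z)) (by fun_prop)
  have hv : ∀ z, inner ℝ v ((ℝ ∙ v)ᗮ.reflection z) = - inner ℝ v z := fun z => by
    rw [← LinearIsometryEquiv.inner_map_map ((ℝ ∙ v)ᗮ.reflection) v z,
      Submodule.reflection_orthogonalComplement_singleton_eq_neg, inner_neg_left, neg_neg]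
  have hw : ∀ z, inner ℝ w ((ℝ ∙ v)ᗮ.reflection z) = inner ℝ w z := fun z => by
    conv_rhs => rw [← LinearIsometryEquiv.inner_map_map ((ℝ ∙ v)ᗮ.reflection) w z]
    rw [Submodule.reflection_mem_subspace_eq_self
      (Submodule.mem_orthogonal_singleton_iff_inner_right.2 h)]
  simp only [hv, hw, neg_mul, integral_neg] at h1
  linarith

/-- The infinitesimal form of rotation invariance in the `(i, j)`-plane. -/
theorem integral_coord_mul_sin_eq {i j : Fin d} (hij : i ≠ j) (s : ℝ) :
    ∫ ω : Sphere d, ω.1 i * Real.sin (s * ω.1 i) ∂(surfaceMeasure d) =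
      s * ∫ ω : Sphere d, ω.1 j ^ 2 * Real.cos (s * ω.1 i) ∂(surfaceMeasure d) := by
  -- Apply the vanishing integral to the orthogonal vectors obtained by rotating `e_j` and `s e_i`
  -- by the angle `θ`, and differentiate at `θ = 0`.
  have hzero : ∀ θ : ℝ, ∫ ω : Sphere d, (Real.cos θ * ω.1 j - Real.sin θ * ω.1 i) *
      Real.sin (s * (Real.cos θ * ω.1 i + Real.sin θ * ω.1 j)) ∂(surfaceMeasure d) = 0 := by
    intro θ
    have h := integral_inner_mul_sin_eq_zero (d := d)
      (v := Real.cos θ • EuclideanSpace.single j (1 : ℝ) -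
        Real.sin θ • EuclideanSpace.single i (1 : ℝ))
      (w := s • (Real.cos θ • EuclideanSpace.single i (1 : ℝ) +
        Real.sin θ • EuclideanSpace.single j (1 : ℝ))) (by
          simp [inner_sub_left, inner_add_right, inner_smul_left, inner_smul_right,
            EuclideanSpace.inner_single_left, hij, hij.symm]
          ring)
    simpa [inner_sub_left, inner_add_left, inner_smul_left, mul_add,
      EuclideanSpace.inner_single_left] using h
  have hder := hasDerivAt_integral_sphere (d := d)
    (F := fun θ ω => (Real.cos θ * ω.1 j - Real.sin θ * ω.1 i) *
      Real.sin (s * (Real.cos θ * ω.1 i + Real.sin θ * ω.1 j)))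
    (F' := fun θ ω => (-Real.sin θ * ω.1 j - Real.cos θ * ω.1 i) *
      Real.sin (s * (Real.cos θ * ω.1 i + Real.sin θ * ω.1 j)) +
      (Real.cos θ * ω.1 j - Real.sin θ * ω.1 i) *
      (Real.cos (s * (Real.cos θ * ω.1 i + Real.sin θ * ω.1 j)) *
        (s * (-Real.sin θ * ω.1 i + Real.cos θ * ω.1 j))))
    (fun θ => by fun_prop) (by unfold Function.uncurry; fun_prop) (fun θ ω =>
      (((Real.hasDerivAt_cos θ).mul_const _).sub ((Real.hasDerivAt_sin θ).mul_const _)).mul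
        ((((Real.hasDerivAt_cos θ).mul_const _).add
          ((Real.hasDerivAt_sin θ).mul_const _)).const_mul s).sin) 0
  simp only [hzero] at hder
  have h0 := hder.unique (hasDerivAt_const (0 : ℝ) (0 : ℝ))
  have hsplit : ∀ ω : Sphere d, (-Real.sin 0 * ω.1 j - Real.cos 0 * ω.1 i) *
      Real.sin (s * (Real.cos 0 * ω.1 i + Real.sin 0 * ω.1 j)) +
      (Real.cos 0 * ω.1 j - Real.sin 0 * ω.1 i) *
      (Real.cos (s * (Real.cos 0 * ω.1 i + Real.sin 0 * ω.1 j)) *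
        (s * (-Real.sin 0 * ω.1 i + Real.cos 0 * ω.1 j))) =
      s * (ω.1 j ^ 2 * Real.cos (s * ω.1 i)) - ω.1 i * Real.sin (s * ω.1 i) := fun ω => by
    simp; ring
  simp only [hsplit] at h0
  rw [integral_sub (integrable_sphere (by fun_prop)) (integrable_sphere (by fun_prop)),
    integral_const_mul] at h0
  linarith

/-- The radial Helmholtz equation `(d - 1) f' + s (f + f'') = 0` for
`f s = ∫ ω, cos (s ω_i)`, with the derivatives of `f` written as integrals. It is the sum of
`integral_coord_mul_sin_eq` over `j ≠ i`, because `∑_{j ≠ i} ω_j ^ 2 = 1 - ω_i ^ 2`. -/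
theorem radial_helmholtz (hd : 2 ≤ d) (i : Fin d) (s : ℝ) :
    ((d : ℝ) - 1) * ∫ ω : Sphere d, ω.1 i * Real.sin (s * ω.1 i) ∂(surfaceMeasure d) =
      s * (∫ ω : Sphere d, Real.cos (s * ω.1 i) ∂(surfaceMeasure d) -
        ∫ ω : Sphere d, ω.1 i ^ 2 * Real.cos (s * ω.1 i) ∂(surfaceMeasure d)) := by
  have hsum : ∑ j ∈ Finset.univ.erase i, ∫ ω : Sphere d, ω.1 i * Real.sin (s * ω.1 i)
      ∂(surfaceMeasure d) = ∑ j ∈ Finset.univ.erase i,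
        s * ∫ ω : Sphere d, ω.1 j ^ 2 * Real.cos (s * ω.1 i) ∂(surfaceMeasure d) :=
    Finset.sum_congr rfl fun j hj => integral_coord_mul_sin_eq (Finset.ne_of_mem_erase hj).symm s
  rw [Finset.sum_const, Finset.card_erase_of_mem (Finset.mem_univ _), Finset.card_univ,
    Fintype.card_fin, nsmul_eq_mul, Nat.cast_sub (by omega), Nat.cast_one, ← Finset.mul_sum,
    ← integral_finsetSum _ fun j _ => integrable_sphere (by fun_prop)] at hsum
  rw [hsum, ← integral_sub (integrable_sphere (by fun_prop)) (integrable_sphere (by fun_prop))]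
  congr 2
  ext ω
  have h := Finset.add_sum_erase Finset.univ (fun j => ω.1 j ^ 2) (Finset.mem_univ i)
  rw [sum_sq_sphere ω] at h
  rw [← Finset.sum_mul, eq_sub_of_add_eq' h]
  ring

/-! ### Decay and Taylor expansion of the spherical average -/

theorem continuous_sphereMean : Continuous (sphereMean d) := by
  unfold sphereMean
  refine continuous_const.mul ?_
  refine continuous_of_dominated (bound := fun _ => 1)
    (fun x => Continuous.aestronglyMeasurable (by fun_prop)) (fun x => ?_) (integrable_const 1) ?_
  · exact Eventually.of_forall fun ω => by simpa using Real.abs_cos_le_one _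
  · exact Eventually.of_forall fun ω => by fun_prop

/-- An exponent `β` for which `sphereMean d x ^ 2 ≤ (1 + ‖x‖ ^ 2) ^ (-β)` holds everywhere
(not the optimal rate of decay at infinity). -/
noncomputable def decayExponent (d : ℕ) : ℝ := 1 / ((d : ℝ) + 1) ^ 2 / 8

theorem decayExponent_pos : 0 < decayExponent d := by
  unfold decayExponent; positivity

theorem sphereMean_sq_le (hd : 2 ≤ d) (x : EuclideanSpace ℝ (Fin d)) :
    sphereMean d x ^ 2 ≤ (1 + ‖x‖ ^ 2) ^ (-decayExponent d) := by
  have hA := (area_pos hd).ne'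
  have : NeZero d := ⟨by omega⟩
  have hd' : (2 : ℝ) ≤ d := by exact_mod_cast hd
  set f : ℝ → ℝ := fun s => (area d)⁻¹ * ∫ ω : Sphere d, Real.cos (s * ω.1 0) ∂(surfaceMeasure d)
    with hf
  set g : ℝ → ℝ := fun s =>
    (area d)⁻¹ * ∫ ω : Sphere d, -(ω.1 0 * Real.sin (s * ω.1 0)) ∂(surfaceMeasure d) with hg
  have hfx : sphereMean d x = f ‖x‖ := by
    rw [sphereMean_eq_of_norm_eq (y := ‖x‖ • EuclideanSpace.single (0 : Fin d) (1 : ℝ))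
      (by simp [norm_smul])]
    simp [sphereMean, hf, inner_smul_left, EuclideanSpace.inner_single_left]
  have hf' : ∀ s, HasDerivAt f (g s) s := fun s =>
    (hasDerivAt_integral_sphere (F := fun s ω => Real.cos (s * ω.1 0))
      (F' := fun s ω => -(ω.1 0 * Real.sin (s * ω.1 0))) (fun t => by fun_prop)
      (by unfold Function.uncurry; fun_prop)
      (fun t ω => (((hasDerivAt_id t).mul_const (ω.1 0)).cos).congr_deriv (by simp; ring))
      s).const_mul _
  have hg' : ∀ s, HasDerivAt g ((area d)⁻¹ *
      ∫ ω : Sphere d, -(ω.1 0 ^ 2 * Real.cos (s * ω.1 0)) ∂(surfaceMeasure d)) s := fun s =>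
    (hasDerivAt_integral_sphere (F := fun s ω => -(ω.1 0 * Real.sin (s * ω.1 0)))
      (F' := fun s ω => -(ω.1 0 ^ 2 * Real.cos (s * ω.1 0))) (fun t => by fun_prop)
      (by unfold Function.uncurry; fun_prop)
      (fun t ω => ((((hasDerivAt_id t).mul_const (ω.1 0)).sin.const_mul (ω.1 0)).neg).congr_deriv
        (by simp; ring)) s).const_mul _
  -- `f'' = -f - ((d - 1) / s) f'`.
  have hode : ∀ s, 0 < s → (area d)⁻¹ *
      ∫ ω : Sphere d, -(ω.1 0 ^ 2 * Real.cos (s * ω.1 0)) ∂(surfaceMeasure d) =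
      -f s - ((d : ℝ) - 1) / s * g s := fun s hs => by
    have h := radial_helmholtz hd 0 s
    simp only [hf, hg, integral_neg]
    have h2 : ∫ ω : Sphere d, ω.1 0 ^ 2 * Real.cos (s * ω.1 0) ∂(surfaceMeasure d) =
      ∫ ω : Sphere d, Real.cos (s * ω.1 0) ∂(surfaceMeasure d) - ((d : ℝ) - 1) / s *
        ∫ ω : Sphere d, ω.1 0 * Real.sin (s * ω.1 0) ∂(surfaceMeasure d) := by
      rw [div_mul_eq_mul_div, h, mul_div_cancel_left₀ _ hs.ne', sub_sub_cancel]
    rw [h2]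
    ring
  have h := sq_le_rpow_of_radial_helmholtz (n := (d : ℝ) - 1) (k := 1 / ((d : ℝ) + 1) ^ 2)
    (by linarith) (by ring_nf) hf'
    (continuous_iff_continuousAt.2 fun s => (hg' s).continuousAt)
    (fun s hs => (hg' s).congr_deriv (hode s hs))
    (by simp only [hf, zero_mul, Real.cos_zero, integral_const_one]; exact inv_mul_cancel₀ hA)
    (by simp [hg]) (norm_nonneg x)
  rw [hfx]
  exact h

theorem abs_sphereMean_le_rpow (hd : 2 ≤ d) (x : EuclideanSpace ℝ (Fin d)) :
    |sphereMean d x| ≤ (1 + ‖x‖ ^ 2) ^ (-(decayExponent d / 2)) := by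
  refine abs_le_of_sq_le_sq ?_ (by positivity)
  rw [← Real.rpow_mul_natCast (by positivity),
    show -(decayExponent d / 2) * (2 : ℕ) = -decayExponent d by push_cast; ring]
  exact sphereMean_sq_le hd x

theorem abs_sphereMean_le_one (hd : 2 ≤ d) (x : EuclideanSpace ℝ (Fin d)) :
    |sphereMean d x| ≤ 1 :=
  (abs_sphereMean_le_rpow hd x).trans <| Real.rpow_le_one_of_one_le_of_nonpos
    (by nlinarith [sq_nonneg ‖x‖]) (by linarith [decayExponent_pos (d := d)])

/-- The difference between `sphereMean` and its Taylor polynomial of degree `2` is the average of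
the same difference for the cosine. -/
theorem sphereMean_sub_eq (hd : 2 ≤ d) (x : EuclideanSpace ℝ (Fin d)) :
    sphereMean d x - (1 - ‖x‖ ^ 2 / (2 * d)) = (area d)⁻¹ * ∫ ω : Sphere d,
      (Real.cos (inner ℝ x ω.1) - (1 - inner ℝ x ω.1 ^ 2 / 2)) ∂(surfaceMeasure d) := by
  have hA := (area_pos hd).ne'
  have hd' : (d : ℝ) ≠ 0 := by positivity
  rw [integral_sub (integrable_sphere (by fun_prop)) (integrable_sphere (by fun_prop)),
    integral_sub (integrable_sphere (by fun_prop)) (integrable_sphere (by fun_prop)),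
    integral_div, integral_inner_sq hd, integral_const_one, sphereMean]
  field_simp

theorem one_sub_le_sphereMean (hd : 2 ≤ d) (x : EuclideanSpace ℝ (Fin d)) :
    1 - ‖x‖ ^ 2 / (2 * d) ≤ sphereMean d x := by
  rw [← sub_nonneg, sphereMean_sub_eq hd]
  exact mul_nonneg (inv_nonneg.2 (area_pos hd).le) (integral_nonneg fun ω =>
    sub_nonneg.2 (Real.one_sub_sq_div_two_le_cos))

theorem abs_inner_sphere_le (x : EuclideanSpace ℝ (Fin d)) (ω : Sphere d) :
    |inner ℝ x ω.1| ≤ ‖x‖ := by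
  simpa using abs_real_inner_le_norm x ω.1

theorem abs_sphereMean_sub_le (hd : 2 ≤ d) {x : EuclideanSpace ℝ (Fin d)} (hx : ‖x‖ ≤ 1) :
    |sphereMean d x - (1 - ‖x‖ ^ 2 / (2 * d))| ≤ ‖x‖ ^ 4 := by
  have hA := area_pos hd
  rw [sphereMean_sub_eq hd, abs_mul, abs_of_pos (inv_pos.2 hA), inv_mul_le_iff₀ hA]
  have h : ∀ ω : Sphere d,
      ‖Real.cos (inner ℝ x ω.1) - (1 - inner ℝ x ω.1 ^ 2 / 2)‖ ≤ ‖x‖ ^ 4 := fun ω => by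
    have h1 := abs_inner_sphere_le x ω
    have h2 := Real.cos_bound (h1.trans hx)
    have h3 : |inner ℝ x ω.1| ^ 4 ≤ ‖x‖ ^ 4 := pow_le_pow_left₀ (abs_nonneg _) h1 4
    have h4 : 0 ≤ |inner ℝ x ω.1| ^ 4 := by positivity
    rw [Real.norm_eq_abs]
    linarith
  have := norm_integral_le_of_norm_le_const (μ := surfaceMeasure d)
    (Eventually.of_forall h)
  rw [Real.norm_eq_abs] at this
  exact this.trans_eq (mul_comm _ _)

/-! ### Parabolic rescaling -/

theorem norm_inv_sqrt_smul_sq {q : ℝ} (hq : 0 < q) (y : EuclideanSpace ℝ (Fin d)) :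
    ‖(√q)⁻¹ • y‖ ^ 2 = ‖y‖ ^ 2 / q := by
  rw [norm_smul, mul_pow, norm_inv, Real.norm_of_nonneg (Real.sqrt_nonneg q), inv_pow,
    Real.sq_sqrt hq.le]
  ring

theorem tendsto_mul_sphereMean_sub_one (hd : 2 ≤ d) (y : EuclideanSpace ℝ (Fin d)) :
    Tendsto (fun q : ℝ => q * (sphereMean d ((√q)⁻¹ • y) - 1)) atTop
      (𝓝 (-(‖y‖ ^ 2 / (2 * d)))) := by
  rw [tendsto_iff_norm_sub_tendsto_zero]
  refine squeeze_zero' (Eventually.of_forall fun _ => norm_nonneg _)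
    (g := fun q => ‖y‖ ^ 4 / q) ?_ (tendsto_const_nhds.div_atTop tendsto_id)
  filter_upwards [eventually_ge_atTop (‖y‖ ^ 2), eventually_gt_atTop 0] with q hq hq0
  have hn := norm_inv_sqrt_smul_sq hq0 y
  have h1 : ‖(√q)⁻¹ • y‖ ≤ 1 := by
    rw [← sq_le_one_iff₀ (norm_nonneg _), hn, div_le_one hq0]
    exact hq
  have h2 := abs_sphereMean_sub_le hd h1
  have h3 : q * (sphereMean d ((√q)⁻¹ • y) - 1) - -(‖y‖ ^ 2 / (2 * d)) =
      q * (sphereMean d ((√q)⁻¹ • y) - (1 - ‖(√q)⁻¹ • y‖ ^ 2 / (2 * d))) := by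
    rw [hn]; field_simp; ring
  have h4 : ‖y‖ ^ 4 / q = q * ‖(√q)⁻¹ • y‖ ^ 4 := by
    rw [show ‖(√q)⁻¹ • y‖ ^ 4 = (‖(√q)⁻¹ • y‖ ^ 2) ^ 2 by ring, hn]; field_simp
  rw [h3, h4, norm_mul, Real.norm_of_nonneg hq0.le, Real.norm_eq_abs]
  exact mul_le_mul_of_nonneg_left h2 hq0.le

theorem tendsto_sphereMean_one (hd : 2 ≤ d) (y : EuclideanSpace ℝ (Fin d)) :
    Tendsto (fun q : ℝ => sphereMean d ((√q)⁻¹ • y)) atTop (𝓝 1) := by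
  have h := (tendsto_inv_atTop_zero (𝕜 := ℝ)).mul (tendsto_mul_sphereMean_sub_one hd y)
  have h2 := h.add_const 1
  simp only [zero_mul, zero_add] at h2
  refine h2.congr' ?_
  filter_upwards [eventually_gt_atTop 0] with q hq
  field_simp
  ring

theorem tendsto_abs_sphereMean_rpow (hd : 2 ≤ d) (y : EuclideanSpace ℝ (Fin d)) :
    Tendsto (fun q : ℝ => |sphereMean d ((√q)⁻¹ • y)| ^ q) atTop
      (𝓝 (Real.exp (-(‖y‖ ^ 2 / (2 * d))))) := by
  have h := Real.tendsto_one_add_rpow_exp_of_tendsto (tendsto_mul_sphereMean_sub_one hd y)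
  refine h.congr' ?_
  filter_upwards [(tendsto_sphereMean_one hd y).eventually (lt_mem_nhds one_pos)] with q hq
  rw [abs_of_pos hq]
  ring_nf

theorem tendsto_mul_one_sub_sq_sphereMean (hd : 2 ≤ d) (y : EuclideanSpace ℝ (Fin d)) :
    Tendsto (fun q : ℝ => q * (1 - sphereMean d ((√q)⁻¹ • y) ^ 2)) atTop
      (𝓝 (‖y‖ ^ 2 / d)) := by
  have h := (tendsto_mul_sphereMean_sub_one hd y).neg.mul
    ((tendsto_sphereMean_one hd y).const_add 1)
  convert h using 2 <;> ring

theorem mul_one_sub_sq_sphereMean_le (hd : 2 ≤ d) {q : ℝ} (hq : 0 < q)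
    (y : EuclideanSpace ℝ (Fin d)) :
    q * (1 - sphereMean d ((√q)⁻¹ • y) ^ 2) ≤ 1 + ‖y‖ ^ 2 := by
  have h1 := one_sub_le_sphereMean hd ((√q)⁻¹ • y)
  have h2 := abs_le.1 (abs_sphereMean_le_one hd ((√q)⁻¹ • y))
  rw [norm_inv_sqrt_smul_sq hq] at h1
  have hd' : (2 : ℝ) ≤ d := by exact_mod_cast hd
  have h3 : 1 - sphereMean d ((√q)⁻¹ • y) ^ 2 ≤ ‖y‖ ^ 2 / q := by
    have : ‖y‖ ^ 2 / q / (2 * d) ≤ ‖y‖ ^ 2 / q / 2 :=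
      div_le_div_of_nonneg_left (by positivity) (by norm_num) (by linarith)
    nlinarith
  calc _ ≤ q * (‖y‖ ^ 2 / q) := mul_le_mul_of_nonneg_left h3 hq.le
    _ = ‖y‖ ^ 2 := by field_simp
    _ ≤ _ := by linarith

/-- A bound on `|u (y / √q)| ^ q` uniform in `q ≥ Q`: the function `q ↦ (1 + ‖y‖ ^ 2 / q) ^ q`
is increasing by Bernoulli's inequality, so the decay available at `q = Q` persists. -/
theorem abs_sphereMean_rpow_le (hd : 2 ≤ d) {Q q : ℝ} (hQ : 1 ≤ Q) (hq : Q ≤ q)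
    (y : EuclideanSpace ℝ (Fin d)) :
    |sphereMean d ((√q)⁻¹ • y)| ^ q ≤ Q ^ (decayExponent d / 2 * Q) *
      (1 + ‖y‖ ^ 2) ^ (-(decayExponent d / 2 * Q)) := by
  have hβ := decayExponent_pos (d := d)
  have hQ0 : 0 < Q := by linarith
  have hq0 : 0 < q := by linarith
  set β := decayExponent d
  have h1 := abs_sphereMean_le_rpow hd ((√q)⁻¹ • y)
  rw [norm_inv_sqrt_smul_sq hq0] at h1
  have hY : 0 < 1 + ‖y‖ ^ 2 := by positivity
  have hb : (1 + ‖y‖ ^ 2) / Q ≤ (1 + ‖y‖ ^ 2 / q) ^ (q / Q) := by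
    have h := one_add_mul_self_le_rpow_one_add (s := ‖y‖ ^ 2 / q)
      (by have : 0 ≤ ‖y‖ ^ 2 / q := by positivity
          linarith) ((one_le_div hQ0).2 hq)
    refine le_trans ?_ h
    have : q / Q * (‖y‖ ^ 2 / q) = ‖y‖ ^ 2 / Q := by field_simp
    rw [this, add_div]
    have : 1 / Q ≤ 1 := (div_le_one hQ0).2 hQ
    linarith
  calc |sphereMean d ((√q)⁻¹ • y)| ^ q ≤ ((1 + ‖y‖ ^ 2 / q) ^ (-(β / 2))) ^ q :=
        Real.rpow_le_rpow (abs_nonneg _) h1 hq0.le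
    _ = ((1 + ‖y‖ ^ 2 / q) ^ (q / Q)) ^ (-(β / 2 * Q)) := by
        rw [← Real.rpow_mul (by positivity), ← Real.rpow_mul (by positivity)]
        congr 1
        field_simp
    _ ≤ ((1 + ‖y‖ ^ 2) / Q) ^ (-(β / 2 * Q)) :=
        Real.rpow_le_rpow_of_nonpos (by positivity) hb (by
          have : 0 ≤ β / 2 * Q := by positivity
          linarith)
    _ = _ := by
        rw [Real.div_rpow hY.le hQ0.le, Real.rpow_neg hQ0.le, div_inv_eq_mul, mul_comm]

/-! ### Convergence of the rescaled integrals -/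

/-- The exponent from which on `|sphereMean d| ^ q` is integrable, with enough room for the
additional weight `1 + ‖x‖ ^ 2`. It is larger than the optimal `2 d / (d - 1)`. -/
noncomputable def integrabilityExponent (d : ℕ) : ℝ := ((d : ℝ) + 3) / decayExponent d

theorem one_le_integrabilityExponent : 1 ≤ integrabilityExponent d := by
  unfold integrabilityExponent
  rw [one_le_div decayExponent_pos]
  have h : ((1 : ℝ)) ≤ ((d : ℝ) + 1) ^ 2 := by nlinarith [(Nat.cast_nonneg d : (0 : ℝ) ≤ d)]
  have h2 : 1 / ((d : ℝ) + 1) ^ 2 ≤ 1 := (div_le_one (by positivity)).2 h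
  have : (0 : ℝ) ≤ d := Nat.cast_nonneg d
  unfold decayExponent
  linarith

/-- An integrable function that dominates `|u (y / √q)| ^ q` and
`q (1 - u (y / √q) ^ 2) |u (y / √q)| ^ q`, with `u = sphereMean d`, for every
`q ≥ integrabilityExponent d`. -/
noncomputable def majorant (d : ℕ) (y : EuclideanSpace ℝ (Fin d)) : ℝ :=
  integrabilityExponent d ^ (((d : ℝ) + 3) / 2) * (1 + ‖y‖ ^ 2) ^ (-((d : ℝ) + 1) / 2)

theorem integrable_majorant : Integrable (majorant d) volume :=
  (integrable_rpow_neg_one_add_norm_sq (by simp)).const_mul _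

theorem one_add_sq_mul_abs_sphereMean_rpow_le (hd : 2 ≤ d) {q : ℝ}
    (hq : integrabilityExponent d ≤ q) (y : EuclideanSpace ℝ (Fin d)) :
    (1 + ‖y‖ ^ 2) * |sphereMean d ((√q)⁻¹ • y)| ^ q ≤ majorant d y := by
  have h := abs_sphereMean_rpow_le hd one_le_integrabilityExponent hq y
  have hY : 0 < 1 + ‖y‖ ^ 2 := by positivity
  have he : decayExponent d / 2 * integrabilityExponent d = ((d : ℝ) + 3) / 2 := by
    have := (decayExponent_pos (d := d)).ne'
    unfold integrabilityExponent
    field_simp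
  rw [he] at h
  refine (mul_le_mul_of_nonneg_left h hY.le).trans_eq ?_
  have hp : (1 + ‖y‖ ^ 2) ^ (-((d : ℝ) + 1) / 2) =
      (1 + ‖y‖ ^ 2) * (1 + ‖y‖ ^ 2) ^ (-(((d : ℝ) + 3) / 2)) := by
    conv_rhs => enter [1]; rw [← Real.rpow_one (1 + ‖y‖ ^ 2)]
    rw [← Real.rpow_add hY]
    congr 1
    ring
  rw [majorant, hp]
  ring

theorem abs_sphereMean_rpow_le_majorant (hd : 2 ≤ d) {q : ℝ}
    (hq : integrabilityExponent d ≤ q) (y : EuclideanSpace ℝ (Fin d)) :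
    |sphereMean d ((√q)⁻¹ • y)| ^ q ≤ majorant d y :=
  (le_mul_of_one_le_left (by positivity) (by nlinarith [sq_nonneg ‖y‖])).trans
    (one_add_sq_mul_abs_sphereMean_rpow_le hd hq y)

theorem continuous_abs_sphereMean_rpow {q : ℝ} (hq : 0 ≤ q) :
    Continuous fun x => |sphereMean d x| ^ q :=
  continuous_sphereMean.abs.rpow_const fun _ => Or.inr hq

theorem integrable_abs_sphereMean_rpow (hd : 2 ≤ d) {q : ℝ}
    (hq : integrabilityExponent d ≤ q) :
    Integrable (fun x => |sphereMean d x| ^ q) volume := by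
  have hq0 : 0 < q := by linarith [one_le_integrabilityExponent (d := d)]
  have hc := continuous_abs_sphereMean_rpow (d := d) hq0.le
  have h : Integrable (fun y => |sphereMean d ((√q)⁻¹ • y)| ^ q) volume := by
    refine integrable_majorant.mono'
      (hc.comp (continuous_const_smul _)).aestronglyMeasurable
      (Eventually.of_forall fun y => ?_)
    rw [Real.norm_of_nonneg (by positivity)]
    exact abs_sphereMean_rpow_le_majorant hd hq y
  exact (integrable_comp_smul_iff volume _ (inv_ne_zero (Real.sqrt_pos.2 hq0).ne')).1 h

theorem tendsto_integral_abs_sphereMean_rpow (hd : 2 ≤ d) :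
    Tendsto (fun q : ℝ => ∫ y : EuclideanSpace ℝ (Fin d), |sphereMean d ((√q)⁻¹ • y)| ^ q) atTop
      (𝓝 (∫ y : EuclideanSpace ℝ (Fin d), Real.exp (-(‖y‖ ^ 2 / (2 * d))))) := by
  refine tendsto_integral_filter_of_dominated_convergence (majorant d) ?_ ?_
    integrable_majorant (Eventually.of_forall fun y => tendsto_abs_sphereMean_rpow hd y)
  · filter_upwards [eventually_ge_atTop 0] with q hq
    exact ((continuous_abs_sphereMean_rpow hq).comp
      (continuous_const_smul _)).aestronglyMeasurable
  · filter_upwards [eventually_ge_atTop (integrabilityExponent d)] with q hq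
    refine Eventually.of_forall fun y => ?_
    rw [Real.norm_of_nonneg (by positivity)]
    exact abs_sphereMean_rpow_le_majorant hd hq y

theorem tendsto_integral_mul_one_sub_sq (hd : 2 ≤ d) :
    Tendsto (fun q : ℝ => ∫ y : EuclideanSpace ℝ (Fin d),
        q * (1 - sphereMean d ((√q)⁻¹ • y) ^ 2) * |sphereMean d ((√q)⁻¹ • y)| ^ q) atTop
      (𝓝 (∫ y : EuclideanSpace ℝ (Fin d), ‖y‖ ^ 2 / d * Real.exp (-(‖y‖ ^ 2 / (2 * d))))) := by
  refine tendsto_integral_filter_of_dominated_convergence (majorant d) ?_ ?_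
    integrable_majorant (Eventually.of_forall fun y =>
      (tendsto_mul_one_sub_sq_sphereMean hd y).mul (tendsto_abs_sphereMean_rpow hd y))
  · filter_upwards [eventually_ge_atTop 0] with q hq
    have h1 : Continuous fun y : EuclideanSpace ℝ (Fin d) => sphereMean d ((√q)⁻¹ • y) :=
      continuous_sphereMean.comp (continuous_const_smul _)
    exact ((continuous_const.mul (continuous_const.sub (h1.pow 2))).mul
      (h1.abs.rpow_const fun _ => Or.inr hq)).aestronglyMeasurable
  · filter_upwards [eventually_ge_atTop (integrabilityExponent d)] with q hq
    have hq0 : 0 < q := by linarith [one_le_integrabilityExponent (d := d)]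
    refine Eventually.of_forall fun y => ?_
    have h1 := (sq_le_one_iff_abs_le_one _).2 (abs_sphereMean_le_one hd ((√q)⁻¹ • y))
    rw [Real.norm_of_nonneg (mul_nonneg (mul_nonneg hq0.le (by linarith)) (by positivity))]
    exact (mul_le_mul_of_nonneg_right (mul_one_sub_sq_sphereMean_le hd hq0 y)
      (by positivity)).trans (one_add_sq_mul_abs_sphereMean_rpow_le hd hq y)

/-! ### Comparison of consecutive moments -/

/-- The second moment of the Gaussian of variance `d` per coordinate in `ℝ^d`, in polar
coordinates: it comes down to `Γ (d / 2 + 1) = (d / 2) Γ (d / 2)`. -/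
theorem integral_norm_sq_mul_gaussian (hd : 2 ≤ d) :
    ∫ y : EuclideanSpace ℝ (Fin d), ‖y‖ ^ 2 / d * Real.exp (-(‖y‖ ^ 2 / (2 * d))) =
      d * ∫ y : EuclideanSpace ℝ (Fin d), Real.exp (-(‖y‖ ^ 2 / (2 * d))) := by
  have : NeZero d := ⟨by omega⟩
  have hd' : (0 : ℝ) < d := by positivity
  have hd1 : ((d - 1 : ℕ) : ℝ) = (d : ℝ) - 1 := by rw [Nat.cast_sub (by omega), Nat.cast_one]
  have hb : (0 : ℝ) < 1 / (2 * d) := by positivity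
  rw [integral_fun_norm_addHaar volume fun r : ℝ => r ^ 2 / d * Real.exp (-(r ^ 2 / (2 * d))),
    integral_fun_norm_addHaar volume fun r : ℝ => Real.exp (-(r ^ 2 / (2 * d)))]
  have h1 := integral_rpow_mul_exp_neg_mul_rpow (p := 2) (q := (d : ℝ) - 1) (by norm_num)
    (by linarith) hb
  have h2 := integral_rpow_mul_exp_neg_mul_rpow (p := 2) (q := (d : ℝ) + 1) (by norm_num)
    (by linarith) hb
  have e1 : ∫ r in Set.Ioi (0 : ℝ), r ^ (d - 1) • Real.exp (-(r ^ 2 / (2 * d))) =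
      ∫ r in Set.Ioi (0 : ℝ), r ^ ((d : ℝ) - 1) * Real.exp (-(1 / (2 * d)) * r ^ (2 : ℝ)) := by
    refine setIntegral_congr_fun measurableSet_Ioi fun r hr => ?_
    simp only [smul_eq_mul]
    rw [← hd1, Real.rpow_natCast, Real.rpow_two]
    ring_nf
  have e2 : ∫ r in Set.Ioi (0 : ℝ), r ^ (d - 1) • (r ^ 2 / d * Real.exp (-(r ^ 2 / (2 * d)))) =
      (d : ℝ)⁻¹ *
      ∫ r in Set.Ioi (0 : ℝ), r ^ ((d : ℝ) + 1) * Real.exp (-(1 / (2 * d)) * r ^ (2 : ℝ)) := by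
    rw [← integral_const_mul]
    refine setIntegral_congr_fun measurableSet_Ioi fun r hr => ?_
    have hr : 0 < r := hr
    simp only [smul_eq_mul]
    rw [show (d : ℝ) + 1 = ((d - 1 : ℕ) : ℝ) + (2 : ℕ) by rw [hd1]; push_cast; ring,
      Real.rpow_add hr, Real.rpow_natCast, Real.rpow_natCast, Real.rpow_two]
    ring_nf
  have hG : Real.Gamma (((d : ℝ) + 1 + 1) / 2) = d / 2 * Real.Gamma (((d : ℝ) - 1 + 1) / 2) := by
    rw [show ((d : ℝ) + 1 + 1) / 2 = d / 2 + 1 by ring, Real.Gamma_add_one (by positivity)]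
    ring_nf
  have hB : (1 / (2 * (d : ℝ))) ^ (-((d : ℝ) + 1 + 1) / 2) =
      2 * d * (1 / (2 * (d : ℝ))) ^ (-((d : ℝ) - 1 + 1) / 2) := by
    rw [show -((d : ℝ) + 1 + 1) / 2 = -((d : ℝ) - 1 + 1) / 2 - 1 by ring,
      Real.rpow_sub_one hb.ne']
    field_simp
  rw [finrank_euclideanSpace_fin, e1, e2, h1, h2, hG, hB]
  simp only [nsmul_eq_mul, smul_eq_mul]
  field_simp

theorem integral_gaussian_pos (hd : 2 ≤ d) :
    0 < ∫ y : EuclideanSpace ℝ (Fin d), Real.exp (-(‖y‖ ^ 2 / (2 * d))) := by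
  have hd' : (0 : ℝ) < d := by positivity
  have h := GaussianFourier.integral_rexp_neg_mul_sq_norm (V := EuclideanSpace ℝ (Fin d))
    (b := 1 / (2 * d)) (by positivity)
  have e : ∀ y : EuclideanSpace ℝ (Fin d), -(‖y‖ ^ 2 / (2 * d)) = -(1 / (2 * d)) * ‖y‖ ^ 2 :=
    fun y => by ring
  simp only [e, h]
  positivity

/-- The comparison of consecutive moments. To first order in `1 / q`, the ratio
`∫ |u| ^ (q + 2) / ∫ |u| ^ q` is `1 - d / q`, while `(1 + q) / (2 d + q - δ)` is
`1 - (2 d - 1 - δ) / q`. -/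
theorem eventually_ratio_lt (hd : 2 ≤ d) {δ : ℝ} (hδ : (d : ℝ) < 2 * d - 1 - δ) :
    ∀ᶠ q : ℝ in atTop, (1 + q) * ∫ x, |sphereMean d x| ^ q <
      (2 * d + q - δ) * ∫ x, |sphereMean d x| ^ (q + 2) := by
  have hJ := tendsto_integral_abs_sphereMean_rpow hd
  have hL := tendsto_integral_mul_one_sub_sq hd
  rw [integral_norm_sq_mul_gaussian hd] at hL
  have hG := integral_gaussian_pos hd
  set G := ∫ y : EuclideanSpace ℝ (Fin d), Real.exp (-(‖y‖ ^ 2 / (2 * d)))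
  have hc : Tendsto (fun q : ℝ => 1 + (2 * d - δ) / q) atTop (𝓝 1) := by
    simpa using (tendsto_const_nhds.div_atTop tendsto_id).const_add (1 : ℝ)
  have hlim := (hJ.const_mul (2 * d - 1 - δ)).sub (hc.mul hL)
  have hpos : 0 < (2 * d - 1 - δ) * G - 1 * (d * G) := by nlinarith
  filter_upwards [hlim.eventually (lt_mem_nhds hpos), eventually_gt_atTop 0,
    eventually_ge_atTop (integrabilityExponent d)] with q hq hq0 hqQ
  have hs : 0 < √q := Real.sqrt_pos.2 hq0
  have e1 := Measure.integral_comp_inv_smul_of_nonneg (volume : Measure (EuclideanSpace ℝ (Fin d)))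
    (fun x => |sphereMean d x| ^ q) hs.le
  have e2 := Measure.integral_comp_inv_smul_of_nonneg (volume : Measure (EuclideanSpace ℝ (Fin d)))
    (fun x => q * (1 - sphereMean d x ^ 2) * |sphereMean d x| ^ q) hs.le
  have hsplit : ∫ x, q * (1 - sphereMean d x ^ 2) * |sphereMean d x| ^ q =
      q * ((∫ x, |sphereMean d x| ^ q) - ∫ x, |sphereMean d x| ^ (q + 2)) := by
    rw [← integral_sub (integrable_abs_sphereMean_rpow hd hqQ)
      (integrable_abs_sphereMean_rpow hd (by linarith)), ← integral_const_mul]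
    congr 1
    ext x
    rw [Real.rpow_add' (abs_nonneg _) (by linarith), Real.rpow_two, sq_abs]
    ring
  rw [hsplit] at e2
  rw [e1, e2] at hq
  simp only [smul_eq_mul] at hq
  set S := √q ^ Module.finrank ℝ (EuclideanSpace ℝ (Fin d))
  have hS : 0 < S := pow_pos hs _
  set D := ∫ x, |sphereMean d x| ^ q
  set D2 := ∫ x, |sphereMean d x| ^ (q + 2)
  -- Undo the scaling: the factor `q` of the second integral cancels the denominator.
  have e3 : (2 * d - 1 - δ) * (S * D) - (1 + (2 * d - δ) / q) * (S * (q * (D - D2))) =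
      S * ((2 * d + q - δ) * D2 - (1 + q) * D) := by
    field_simp
    ring
  rw [e3] at hq
  have := (mul_pos_iff_of_pos_left hS).1 hq
  linarith

/-! ### The functional at the constant function -/

theorem memLp_extension_one (hd : 2 ≤ d) {q : ℝ} (hq : integrabilityExponent d ≤ q) :
    MemLp (extension d (one d)) (ENNReal.ofReal q) volume := by
  have hq0 : 0 < q := by linarith [one_le_integrabilityExponent (d := d)]
  have he : extension d (one d) = fun x => ((area d * sphereMean d x : ℝ) : ℂ) :=
    funext (extension_one hd)
  have hc : Continuous (extension d (one d)) := by
    rw [he]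
    exact Complex.continuous_ofReal.comp (continuous_const.mul continuous_sphereMean)
  rw [← integrable_norm_rpow_iff hc.aestronglyMeasurable (by simpa using hq0) (by simp),
    ENNReal.toReal_ofReal hq0.le, he]
  refine ((integrable_abs_sphereMean_rpow hd hq).const_mul (area d ^ q)).congr
    (Eventually.of_forall fun x => ?_)
  simp only [Complex.norm_real, norm_mul, Real.norm_eq_abs, abs_of_pos (area_pos hd)]
  rw [Real.mul_rpow (area_pos hd).le (abs_nonneg _)]

theorem Phi_one (hd : 2 ≤ d) {q : ℝ} (hq : integrabilityExponent d ≤ q) :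
    Phi d q (one d) = √(area d) ^ q * ∫ x, |sphereMean d x| ^ q := by
  have hA := area_pos hd
  have hq0 : 0 < q := by linarith [one_le_integrabilityExponent (d := d)]
  have hne : (surfaceMeasure d) ≠ 0 := fun h => by simp [area, h] at hA
  have h2 : (eLpNorm (one d) 2 (surfaceMeasure d)).toReal = √(area d) := by
    unfold one
    rw [eLpNorm_const _ (by norm_num) hne, ENNReal.toReal_mul, ← ENNReal.toReal_rpow]
    simp [area, Real.sqrt_eq_rpow]
  have h1 : (eLpNorm (extension d (one d)) (ENNReal.ofReal q) volume).toReal ^ q =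
      area d ^ q * ∫ x, |sphereMean d x| ^ q := by
    rw [(memLp_extension_one hd hq).eLpNorm_eq_integral_rpow_norm (by simpa using hq0) (by simp),
      ENNReal.toReal_ofReal hq0.le, ENNReal.toReal_ofReal (by positivity),
      ← Real.rpow_mul (by positivity), inv_mul_cancel₀ hq0.ne', Real.rpow_one,
      ← integral_const_mul]
    congr 1
    ext x
    rw [extension_one hd, Complex.norm_real, norm_mul, Real.norm_eq_abs, Real.norm_eq_abs,
      abs_of_pos hA, Real.mul_rpow hA.le (abs_nonneg _)]
  rw [Phi, h1, h2]
  conv_lhs => enter [1, 1, 1]; rw [← Real.mul_self_sqrt hA.le]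
  rw [Real.mul_rpow (Real.sqrt_nonneg _) (Real.sqrt_nonneg _)]
  have := (Real.rpow_pos_of_pos (Real.sqrt_pos.2 hA) q).ne'
  field_simp

end SphereExtension

theorem mainTheorem9 (d : ℕ) (hd : 2 ≤ d) :
    ∃ qs : ℝ, 2 * (((d : ℝ) + 1) / ((d : ℝ) - 1)) ≤ qs ∧
      ∀ q : ℝ, qs ≤ q →
        MemLp (SphereExtension.extension d (SphereExtension.one d)) (ENNReal.ofReal q) volume ∧
        SphereExtension.Phi d (q + 2) (SphereExtension.one d) >
          SphereExtension.gamma d q * SphereExtension.Phi d q (SphereExtension.one d) := by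
  have hd' : (2 : ℝ) ≤ d := by exact_mod_cast hd
  -- The inequality reads `1 + δ < d`, and `δ = 1` only for `d = 4`.
  have hδ : (d : ℝ) < 2 * d - 1 - (if d = 4 then 1 else 0 : ℝ) := by
    rcases eq_or_ne d 4 with rfl | h
    · norm_num
    rcases eq_or_lt_of_le hd with rfl | h2
    · norm_num
    · have : (3 : ℝ) ≤ d := by exact_mod_cast h2
      rw [if_neg h]
      linarith
  have hev := (SphereExtension.eventually_ratio_lt hd hδ).and
    (Filter.eventually_ge_atTop (SphereExtension.integrabilityExponent d))
  obtain ⟨q₀, hq₀⟩ := Filter.eventually_atTop.1 hev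
  refine ⟨max q₀ (2 * (((d : ℝ) + 1) / ((d : ℝ) - 1))), le_max_right _ _, fun q hq => ?_⟩
  obtain ⟨hlt, hqQ⟩ := hq₀ q ((le_max_left _ _).trans hq)
  refine ⟨SphereExtension.memLp_extension_one hd hqQ, ?_⟩
  have hA := SphereExtension.area_pos hd
  have hq1 := SphereExtension.one_le_integrabilityExponent (d := d)
  have hden : 0 < 2 * (d : ℝ) + q - (if d = 4 then 1 else 0 : ℝ) := by linarith
  have hs := Real.sqrt_pos.2 hA
  rw [SphereExtension.Phi_one hd hqQ, SphereExtension.Phi_one hd (by linarith),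
    SphereExtension.gamma, Real.rpow_add hs, Real.rpow_two, Real.sq_sqrt hA.le]
  have hS := Real.rpow_pos_of_pos hs q
  set S := √(SphereExtension.area d) ^ q
  set D := ∫ x, |SphereExtension.sphereMean d x| ^ q
  set D2 := ∫ x, |SphereExtension.sphereMean d x| ^ (q + 2)
  have hdiv : (1 + q) / (2 * (d : ℝ) + q - (if d = 4 then 1 else 0 : ℝ)) * D < D2 := by
    rw [div_mul_eq_mul_div, div_lt_iff₀' hden]
    exact hlt
  calc _ = SphereExtension.area d * S *
        ((1 + q) / (2 * (d : ℝ) + q - (if d = 4 then 1 else 0 : ℝ)) * D) := by ring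
    _ < SphereExtension.area d * S * D2 := mul_lt_mul_of_pos_left hdiv (mul_pos hA hS)
    _ = _ := by ring
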